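/- Consider the problem $\max\{f(S) : S\in\mathcal B\}$, where $f:2^X\to\mathbb R_{\ge 0}$ is a nonnegative (not necessarily monotone) submodular function on a finite ground set $X$, i.e. $f(S\cup T)+f(S\cap T)\le f(S)+f(T)$ for all $S,T\subseteq X$, and $\mathcal B$ is the collection of bases of a matroid on $X$. The function $f$ is accessible through a value oracle, returning $f(S)$ for a queried set $S$, and $\mathcal B$ through a membership oracle, answering whether $S\in\mathcal B$; algorithms are adaptive, may be randomized, have unlimited computational power, and halt on every run. An algorithm is a $c$-approximation on ground sets of size $n$ if, on every instance with $|X|=n$, the expected value of the returned solution (counted as $0$ if the returned set is not a base) is at least $c\cdot\max_{B\in\mathcal B} f(B)$. Then any constant-factor approximation requires exponentially many value queries: for every constant $c>0$ there are $\delta>0$ and $n_0$, depending only on $c$, such that for every $n\ge n_0$ and every randomized $c$-approximation algorithm on ground sets of size $n$ there is an instance with $|X|=n$ on which the expected number of value queries made by the algorithm (membership queries not being counted) is at least $e^{\delta n}$. -/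

import Mathlib

open MeasureTheory

universe u

/-- A set function on `Fin n` is submodular. -/
def SubmodularSetFunction {n : ℕ} (f : Finset (Fin n) → ℝ) : Prop :=
  ∀ S T : Finset (Fin n), f (S ∪ T) + f (S ∩ T) ≤ f S + f T

/-- An instance of `max {f(S) : S ∈ 𝓑}` on a ground set of `n` elements: a nonnegative submodular
function `f`, and a matroid whose ground set is all of `Fin n`, with `𝓑` its family of bases. -/
structure MatroidBaseInstance (n : ℕ) where
  matroid : Matroid (Fin n)
  ground_eq : matroid.E = Set.univ
  f : Finset (Fin n) → ℝ
  nonneg : ∀ S, 0 ≤ f S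
  submodular : SubmodularSetFunction f

/-- The feasible solutions: the bases of the matroid. -/
def MatroidBaseInstance.Feasible {n : ℕ} (I : MatroidBaseInstance n) (S : Finset (Fin n)) : Prop :=
  I.matroid.IsBase (S : Set (Fin n))

/-- A deterministic adaptive algorithm on the ground set `Fin n` in the oracle model, as a decision
tree of unrestricted computational power. It may stop and output a set, ask the value oracle for
`f(S)` and continue depending on the real number returned, or ask the membership oracle whether `S`
is feasible and continue depending on the answer. The tree is well founded, so every run stops. -/
inductive OracleAlgorithm (n : ℕ) : Type
  | output (S : Finset (Fin n)) : OracleAlgorithm n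
  | value (S : Finset (Fin n)) (next : ℝ → OracleAlgorithm n) : OracleAlgorithm n
  | member (S : Finset (Fin n)) (ifYes ifNo : OracleAlgorithm n) : OracleAlgorithm n

open Classical in
/-- The set returned by the algorithm on the instance `I`. -/
noncomputable def OracleAlgorithm.result {n : ℕ} (I : MatroidBaseInstance n) :
    OracleAlgorithm n → Finset (Fin n)
  | .output S => S
  | .value S next => (next (I.f S)).result I
  | .member S ifYes ifNo => if I.Feasible S then ifYes.result I else ifNo.result I

open Classical in
/-- The number of value queries made by the algorithm on the instance `I`
(membership queries are not counted). -/
noncomputable def OracleAlgorithm.valueQueries {n : ℕ} (I : MatroidBaseInstance n) :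
    OracleAlgorithm n → ℕ
  | .output _ => 0
  | .value S next => (next (I.f S)).valueQueries I + 1
  | .member S ifYes ifNo =>
      if I.Feasible S then ifYes.valueQueries I else ifNo.valueQueries I

/-- A randomized algorithm: a deterministic algorithm `alg ω` for each outcome `ω` of an arbitrary
probability space of random bits, such that on each instance the returned set and the number of
value queries are random variables. -/
structure RandomizedAlgorithm (n : ℕ) : Type (u + 1) where
  Ω : Type u
  [measurableSpace : MeasurableSpace Ω]
  μ : Measure Ω
  [isProbabilityMeasure : IsProbabilityMeasure μ]
  alg : Ω → OracleAlgorithm n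
  measurableSet_result : ∀ (I : MatroidBaseInstance n) (S : Finset (Fin n)),
    MeasurableSet {ω | (alg ω).result I = S}
  measurableSet_valueQueries : ∀ (I : MatroidBaseInstance n) (q : ℕ),
    MeasurableSet {ω | (alg ω).valueQueries I = q}

attribute [instance] RandomizedAlgorithm.measurableSpace RandomizedAlgorithm.isProbabilityMeasure

open Classical in
/-- The expected value of the solution returned on `I`; an infeasible answer is worth `0`. -/
noncomputable def RandomizedAlgorithm.expectedValue {n : ℕ} (A : RandomizedAlgorithm.{u} n)
    (I : MatroidBaseInstance n) : ℝ :=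
  ∫ ω, (if I.Feasible ((A.alg ω).result I) then I.f ((A.alg ω).result I) else 0) ∂A.μ

/-- The expected number of value queries made on `I`. -/
noncomputable def RandomizedAlgorithm.expectedValueQueries {n : ℕ} (A : RandomizedAlgorithm.{u} n)
    (I : MatroidBaseInstance n) : ENNReal :=
  ∫⁻ ω, ((A.alg ω).valueQueries I : ENNReal) ∂A.μ

/-- `A` is a `c`-approximation on ground sets of `n` elements: on every instance, the expected value
of the returned solution is at least `c` times the value of every feasible solution. -/
def RandomizedAlgorithm.IsApproximation {n : ℕ} (c : ℝ) (A : RandomizedAlgorithm.{u} n) : Prop :=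
  ∀ (I : MatroidBaseInstance n) (B : Finset (Fin n)), I.Feasible B → c * I.f B ≤ A.expectedValue I

/-! The proof hides a directed cut behind a symmetric objective. Blocks `A`, `B` of size `N = (K +
1) * a` contain secret parts `A₁`, `B₁` of size `a`; a base takes `a` elements of `A` and `K * a` of
`B`. If `x`, `y` count the chosen elements and `p`, `q` are the imbalances with respect to the
secret parts, then `K * x * (N - y) + p * q` is a weighted directed cut from `A₁` to `B₁` and from
`A \ A₁` to `B \ B₁`. The base `A₁ ∪ (B \ B₁)` gives it a value of order `K² a²`, whereas `K * x *
(N - y)` alone equals `K a²` on every base.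

To conceal the term `p * q`, it is replaced by a function `Ψ` that vanishes for `|p|, |q| ≤ b` but
keeps at least three quarters of the product at the optimum (`exists_isMild`). `Ψ` averages `p * q -
clamp_j p * clamp_j q` over a long range of scales `j` with weights proportional to `1 / j`. At each
point only one scale can have a kink, so the second differences in one variable are tiny; the
concave term `(x(N-x) + y(N-y))/2` absorbs them and costs only another `K a²` on bases. The mixed
differences are absorbed by `K * x * (N - y)` (`submodular_objective`).

For a random transversal as secret part, a Chernoff bound shows that a fixed set has an imbalance
above `b` with probability exponentially small in `b`, and `b` is proportional to `n`
(`card_objective_ne_le`). The matroid does not depend on the secret. An algorithm making few value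
queries on the symmetric instance therefore behaves identically on most hidden instances, and
returns there a value at most `2 K a²` (`sum_expectedValue_le`), against an optimum of at least `3/4
K² a²`. Taking `K > 4 / c` gives a contradiction. -/

/-! ### Truncation and the flattened product. -/

/-- Truncation of an integer to the interval `[-j, j]`. -/
def clampInt (j : ℕ) (x : ℤ) : ℤ := max (-(j : ℤ)) (min j x)

theorem clampInt_of_abs_le {j : ℕ} {x : ℤ} (h : |x| ≤ j) : clampInt j x = x := by
  rw [abs_le] at h; unfold clampInt; omega

theorem clampInt_of_le {j : ℕ} {x : ℤ} (h : (j : ℤ) ≤ x) : clampInt j x = j := by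
  unfold clampInt; omega

theorem abs_clampInt_le (j : ℕ) (x : ℤ) : |clampInt j x| ≤ j := by
  rw [abs_le]; unfold clampInt; omega

theorem clampInt_nonneg (j : ℕ) {x : ℤ} (h : 0 ≤ x) : 0 ≤ clampInt j x := by
  unfold clampInt; omega

theorem clampInt_le (j : ℕ) {x : ℤ} (h : 0 ≤ x) : clampInt j x ≤ x := by
  unfold clampInt; omega

theorem clampInt_nonpos (j : ℕ) {x : ℤ} (h : x ≤ 0) : clampInt j x ≤ 0 := by
  unfold clampInt; omega

theorem le_clampInt (j : ℕ) {x : ℤ} (h : x ≤ 0) : x ≤ clampInt j x := by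
  unfold clampInt; omega

/-- Truncation is piecewise linear with slopes 0 and 1, so it bends only at `j` and `-j`, by one
unit. -/
theorem abs_clampInt_second_diff_le (j : ℕ) (x : ℤ) :
    |clampInt j (x + 2) - 2 * clampInt j (x + 1) + clampInt j x|
      ≤ if j = (x + 1).natAbs then 1 else 0 := by
  rw [abs_le]; unfold clampInt; split_ifs <;> constructor <;> omega

theorem sum_abs_clampInt_second_diff_le (s : Finset ℕ) (x : ℤ) :
    ∑ j ∈ s, |clampInt j (x + 2) - 2 * clampInt j (x + 1) + clampInt j x| ≤ 1 := by
  refine (Finset.sum_le_sum fun j _ => abs_clampInt_second_diff_le j x).trans ?_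
  rw [Finset.sum_ite_eq']
  split_ifs <;> norm_num

/-- Truncation is monotone and 1-Lipschitz, so its increments lie between 0 and `s`, respectively
`t`; their product lies between 0 and `s * t`. -/
theorem clampInt_mixed_diff_le (j : ℕ) (p q s t : ℤ) :
    s * t - (clampInt j (p + s) - clampInt j p) * (clampInt j (q + t) - clampInt j q)
      ≤ max 0 (s * t) := by
  have key : ∀ x u : ℤ, (0 ≤ u → 0 ≤ clampInt j (x + u) - clampInt j x ∧
      clampInt j (x + u) - clampInt j x ≤ u) ∧ (u ≤ 0 → clampInt j (x + u) - clampInt j x ≤ 0 ∧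
      u ≤ clampInt j (x + u) - clampInt j x) := by
    intro x u; unfold clampInt; omega
  generalize hα : clampInt j (p + s) - clampInt j p = α
  generalize hβ : clampInt j (q + t) - clampInt j q = β
  have h1 := key p s
  have h2 := key q t
  rw [hα] at h1; rw [hβ] at h2
  rcases le_total 0 s with hs | hs <;> rcases le_total 0 t with ht | ht
  · have := h1.1 hs; have := h2.1 ht
    refine le_max_of_le_right ?_; nlinarith
  · have := h1.1 hs; have := h2.2 ht
    refine le_max_of_le_left ?_; nlinarith
  · have := h1.2 hs; have := h2.1 ht
    refine le_max_of_le_left ?_; nlinarith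
  · have := h1.2 hs; have := h2.2 ht
    refine le_max_of_le_right ?_; nlinarith

/-- The product of the truncations has the sign of `p * q` and is no larger in absolute value. -/
theorem clampInt_mul_bounds (j : ℕ) (p q : ℤ) :
    min 0 (p * q) ≤ p * q - clampInt j p * clampInt j q ∧
      |p * q - clampInt j p * clampInt j q| ≤ |p * q| := by
  have P := @clampInt_nonneg j p
  have P1 := @clampInt_le j p
  have P2 := @clampInt_nonpos j p
  have P3 := @le_clampInt j p
  have Q := @clampInt_nonneg j q
  have Q1 := @clampInt_le j q
  have Q2 := @clampInt_nonpos j q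
  have Q3 := @le_clampInt j q
  generalize clampInt j p = α at *
  generalize clampInt j q = β at *
  rcases le_total 0 p with hp | hp <;> rcases le_total 0 q with hq | hq
  · have := P hp; have := P1 hp; have := Q hq; have := Q1 hq
    have h0 : 0 ≤ p * q := by positivity
    have h1 : 0 ≤ α * β := by positivity
    have h2 : α * β ≤ p * q := by gcongr
    rw [abs_of_nonneg h0, abs_of_nonneg (by linarith)]
    exact ⟨by rw [min_eq_left h0]; linarith, by linarith⟩
  · have := P hp; have := P1 hp; have := Q2 hq; have := Q3 hq
    have h0 : p * q ≤ 0 := by nlinarith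
    have h1 : α * β ≤ 0 := by nlinarith
    have h2 : p * q ≤ α * β := by nlinarith
    rw [abs_of_nonpos h0, abs_of_nonpos (by linarith)]
    exact ⟨by rw [min_eq_right h0]; linarith, by linarith⟩
  · have := P2 hp; have := P3 hp; have := Q hq; have := Q1 hq
    have h0 : p * q ≤ 0 := by nlinarith
    have h1 : α * β ≤ 0 := by nlinarith
    have h2 : p * q ≤ α * β := by nlinarith
    rw [abs_of_nonpos h0, abs_of_nonpos (by linarith)]
    exact ⟨by rw [min_eq_right h0]; linarith, by linarith⟩
  · have := P2 hp; have := P3 hp; have := Q2 hq; have := Q3 hq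
    have h0 : 0 ≤ p * q := by nlinarith
    have h1 : 0 ≤ α * β := by nlinarith
    have h2 : α * β ≤ p * q := by nlinarith
    rw [abs_of_nonneg h0, abs_of_nonneg (by linarith)]
    exact ⟨by rw [min_eq_left h0]; linarith, by linarith⟩

/-- The product `p * q` made to vanish near the origin, by averaging over the scales `j ∈ s` with
weights `w j`. -/
noncomputable def flatProd (s : Finset ℕ) (w : ℕ → ℝ) (p q : ℤ) : ℝ :=
  ∑ j ∈ s, w j * ((p * q - clampInt j p * clampInt j q : ℤ) : ℝ)

theorem flatProd_comm (s : Finset ℕ) (w : ℕ → ℝ) (p q : ℤ) :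
    flatProd s w p q = flatProd s w q p := by
  unfold flatProd
  refine Finset.sum_congr rfl fun j _ => ?_
  rw [mul_comm p q, mul_comm (clampInt j p)]

section flatProd

variable {s : Finset ℕ} {w : ℕ → ℝ}

theorem flatProd_eq_zero {b : ℕ} (hb : ∀ j ∈ s, b ≤ j) {p q : ℤ} (hp : |p| ≤ b) (hq : |q| ≤ b) :
    flatProd s w p q = 0 := by
  refine Finset.sum_eq_zero fun j hj => ?_
  have hbj : (b : ℤ) ≤ j := by exact_mod_cast hb j hj
  rw [clampInt_of_abs_le (hp.trans hbj), clampInt_of_abs_le (hq.trans hbj)]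
  simp

theorem flatProd_mixed_diff_le (hw0 : ∀ j ∈ s, 0 ≤ w j) (hw1 : ∑ j ∈ s, w j = 1)
    (p q σ τ : ℤ) :
    flatProd s w (p + σ) (q + τ) - flatProd s w (p + σ) q - flatProd s w p (q + τ)
      + flatProd s w p q ≤ max 0 (σ * τ : ℤ) := by
  have h : flatProd s w (p + σ) (q + τ) - flatProd s w (p + σ) q - flatProd s w p (q + τ)
      + flatProd s w p q = ∑ j ∈ s, w j * ((σ * τ - (clampInt j (p + σ) - clampInt j p) *
        (clampInt j (q + τ) - clampInt j q) : ℤ) : ℝ) := by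
    unfold flatProd
    rw [← Finset.sum_sub_distrib, ← Finset.sum_sub_distrib, ← Finset.sum_add_distrib]
    refine Finset.sum_congr rfl fun j _ => ?_
    push_cast; ring
  rw [h]
  calc _ ≤ ∑ j ∈ s, w j * ((max 0 (σ * τ) : ℤ) : ℝ) := by
        refine Finset.sum_le_sum fun j hj => mul_le_mul_of_nonneg_left ?_ (hw0 j hj)
        exact_mod_cast clampInt_mixed_diff_le j p q σ τ
    _ = _ := by rw [← Finset.sum_mul, hw1, one_mul]

/-- Only the scale `j = |p + 1|` can contribute, and there the factor `clampInt j q` is at most `j`.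
Weights with `w j * j` uniformly small thus make every second difference small. -/
theorem abs_flatProd_second_diff_le {η : ℝ} (hw0 : ∀ j ∈ s, 0 ≤ w j)
    (hw : ∀ j ∈ s, w j * j ≤ η) (hη : 0 ≤ η) (p q : ℤ) :
    |flatProd s w (p + 2) q - 2 * flatProd s w (p + 1) q + flatProd s w p q| ≤ η := by
  have h : flatProd s w (p + 2) q - 2 * flatProd s w (p + 1) q + flatProd s w p q =
      ∑ j ∈ s, w j * (-((clampInt j (p + 2) - 2 * clampInt j (p + 1) + clampInt j p : ℤ) : ℝ)
        * (clampInt j q : ℝ)) := by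
    unfold flatProd
    rw [Finset.mul_sum, ← Finset.sum_sub_distrib, ← Finset.sum_add_distrib]
    refine Finset.sum_congr rfl fun j _ => ?_
    push_cast; ring
  rw [h]
  calc _ ≤ ∑ j ∈ s, η *
        ((|clampInt j (p + 2) - 2 * clampInt j (p + 1) + clampInt j p| : ℤ) : ℝ) := by
        refine (Finset.abs_sum_le_sum_abs _ _).trans (Finset.sum_le_sum fun j hj => ?_)
        rw [abs_mul, abs_mul, abs_neg, abs_of_nonneg (hw0 j hj), Int.cast_abs]
        have hc : |(clampInt j q : ℝ)| ≤ j := by exact_mod_cast abs_clampInt_le j q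
        calc _ ≤ w j * (|((clampInt j (p + 2) - 2 * clampInt j (p + 1) + clampInt j p : ℤ) : ℝ)|
              * j) := by
              have := hw0 j hj
              gcongr
          _ = (w j * j) * |((clampInt j (p + 2) - 2 * clampInt j (p + 1) + clampInt j p : ℤ) : ℝ)|
              := by ring
          _ ≤ _ := by gcongr; exact hw j hj
    _ ≤ η * 1 := by
        rw [← Finset.mul_sum, ← Int.cast_sum]
        gcongr
        exact_mod_cast sum_abs_clampInt_second_diff_le s p
    _ = η := mul_one η

theorem min_le_flatProd (hw0 : ∀ j ∈ s, 0 ≤ w j) (hw1 : ∑ j ∈ s, w j = 1) (p q : ℤ) :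
    min 0 ((p : ℝ) * q) ≤ flatProd s w p q := by
  calc min 0 ((p : ℝ) * q) = ∑ j ∈ s, w j * ((min 0 (p * q) : ℤ) : ℝ) := by
        rw [← Finset.sum_mul, hw1, one_mul]; push_cast; rfl
    _ ≤ _ := by
        refine Finset.sum_le_sum fun j hj => mul_le_mul_of_nonneg_left ?_ (hw0 j hj)
        exact_mod_cast (clampInt_mul_bounds j p q).1

theorem flatProd_le_abs (hw0 : ∀ j ∈ s, 0 ≤ w j) (hw1 : ∑ j ∈ s, w j = 1) (p q : ℤ) :
    flatProd s w p q ≤ |(p : ℝ) * q| := by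
  calc flatProd s w p q ≤ ∑ j ∈ s, w j * ((|p * q| : ℤ) : ℝ) := by
        refine Finset.sum_le_sum fun j hj => mul_le_mul_of_nonneg_left ?_ (hw0 j hj)
        exact_mod_cast (le_abs_self _).trans (clampInt_mul_bounds j p q).2
    _ = _ := by rw [← Finset.sum_mul, hw1, one_mul]; push_cast; rfl

/-- Every scale truncates `p` to `j ≤ p / 2`, which leaves `p ^ 2 - j ^ 2 ≥ 3/4 * p ^ 2`. -/
theorem le_flatProd_self (hw0 : ∀ j ∈ s, 0 ≤ w j) (hw1 : ∑ j ∈ s, w j = 1) {p : ℕ}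
    (hs : ∀ j ∈ s, 2 * j ≤ p) : 3 / 4 * (p : ℝ) ^ 2 ≤ flatProd s w p p := by
  calc 3 / 4 * (p : ℝ) ^ 2 = ∑ j ∈ s, w j * (3 / 4 * (p : ℝ) ^ 2) := by
        rw [← Finset.sum_mul, hw1, one_mul]
    _ ≤ _ := by
        refine Finset.sum_le_sum fun j hj => mul_le_mul_of_nonneg_left ?_ (hw0 j hj)
        have h := hs j hj
        rw [clampInt_of_le (by exact_mod_cast (by omega : j ≤ p))]
        have h' : 2 * (j : ℝ) ≤ p := by exact_mod_cast h
        push_cast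
        nlinarith [(j.cast_nonneg : (0 : ℝ) ≤ j)]

end flatProd

/-! ### Second differences and submodularity. -/

/-- A function on `ℤ` with bounded unit second differences has bounded second differences. -/
theorem abs_second_diff_le_of_nat {φ : ℤ → ℝ} {η : ℝ}
    (h : ∀ x, |φ (x + 2) - 2 * φ (x + 1) + φ x| ≤ η) (x : ℤ) (σ τ : ℕ) :
    |φ (x + σ + τ) - φ (x + σ) - φ (x + τ) + φ x| ≤ η * (σ * τ) := by
  have h1 : ∀ (σ : ℕ) (x : ℤ), |φ (x + σ + 1) - φ (x + σ) - φ (x + 1) + φ x| ≤ η * σ := by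
    intro σ
    induction σ with
    | zero => intro x; simp
    | succ m ih =>
      intro x
      have e1 := h (x + m)
      have e2 := ih x
      rw [show x + (m : ℤ) + 2 = x + ((m + 1 : ℕ) : ℤ) + 1 by push_cast; ring,
        show x + (m : ℤ) + 1 = x + ((m + 1 : ℕ) : ℤ) by push_cast; ring] at e1
      rw [show x + (m : ℤ) + 1 = x + ((m + 1 : ℕ) : ℤ) by push_cast; ring] at e2
      rw [abs_le] at e1 e2 ⊢
      push_cast at e1 e2 ⊢
      constructor <;> linarith [e1.1, e1.2, e2.1, e2.2]
  induction τ with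
  | zero => simp
  | succ m ih =>
    have e1 := h1 σ (x + m)
    rw [show x + (m : ℤ) + σ + 1 = x + σ + ((m + 1 : ℕ) : ℤ) by push_cast; ring,
      show x + (m : ℤ) + σ = x + σ + m by ring,
      show x + (m : ℤ) + 1 = x + ((m + 1 : ℕ) : ℤ) by push_cast; ring] at e1
    rw [abs_le] at e1 ih ⊢
    push_cast at e1 ih ⊢
    constructor <;> linarith [e1.1, e1.2, ih.1, ih.2]

/-- Moving the base point turns a negative step into a positive one, up to the sign of the
difference. -/
theorem abs_second_diff_le {φ : ℤ → ℝ} {η : ℝ}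
    (h : ∀ x, |φ (x + 2) - 2 * φ (x + 1) + φ x| ≤ η) (x σ τ : ℤ) :
    |φ (x + σ + τ) - φ (x + σ) - φ (x + τ) + φ x| ≤ η * (|σ| * |τ| : ℤ) := by
  have key := abs_second_diff_le_of_nat h
  obtain ⟨m, rfl | rfl⟩ := σ.eq_nat_or_neg <;> obtain ⟨l, rfl | rfl⟩ := τ.eq_nat_or_neg
  · simpa using key x m l
  · have := key (x - l) m l
    rw [← abs_neg, show x - (l : ℤ) + m + l = x + m by ring,
      show x - (l : ℤ) + m = x + m + -l by ring, show x - (l : ℤ) + l = x by ring,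
      show x - (l : ℤ) = x + -l by ring] at this
    push_cast; simp only [abs_neg, Nat.abs_cast]
    convert this using 2; ring
  · have := key (x - m) m l
    rw [← abs_neg, show x - (m : ℤ) + m + l = x + l by ring,
      show x - (m : ℤ) + l = x + -m + l by ring, show x - (m : ℤ) + m = x by ring,
      show x - (m : ℤ) = x + -m by ring] at this
    push_cast; simp only [abs_neg, Nat.abs_cast]
    convert this using 2; ring
  · have := key (x - m - l) m l
    rw [show x - (m : ℤ) - l + m + l = x by ring,
      show x - (m : ℤ) - l + m = x + -l by ring, show x - (m : ℤ) - l + l = x + -m by ring,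
      show x - (m : ℤ) - l = x + -m + -l by ring] at this
    push_cast; simp only [abs_neg, Nat.abs_cast]
    convert this using 2; ring

/-- A function of a vector-valued modular set function is submodular as soon as its mixed second
differences along the steps of single elements are nonpositive. -/
theorem submodular_of_steps {n : ℕ} {M : Type*} [AddCommGroup M] (H : M → ℝ) (v : Fin n → M)
    (h : ∀ i j z, H (z + v i + v j) + H z ≤ H (z + v i) + H (z + v j)) :
    SubmodularSetFunction fun S : Finset (Fin n) => H (∑ i ∈ S, v i) := by
  have h1 : ∀ i (T : Finset (Fin n)) z,
      H (z + v i + ∑ j ∈ T, v j) + H z ≤ H (z + v i) + H (z + ∑ j ∈ T, v j) := by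
    intro i T
    induction T using Finset.induction_on with
    | empty => intro z; simp
    | insert a T ha ih =>
      intro z
      rw [Finset.sum_insert ha]
      have e1 := ih (z + v a)
      have e2 := h i a z
      rw [show z + v a + v i = z + v i + v a by abel] at e1
      rw [← add_assoc, ← add_assoc]
      linarith
  have h2 : ∀ S T : Finset (Fin n), ∀ z,
      H (z + ∑ i ∈ S, v i + ∑ j ∈ T, v j) + H z ≤ H (z + ∑ i ∈ S, v i) + H (z + ∑ j ∈ T, v j) := by
    intro S T
    induction S using Finset.induction_on with
    | empty => intro z; simp [add_comm]
    | insert a S ha ih =>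
      intro z
      rw [Finset.sum_insert ha]
      have e1 := ih (z + v a)
      have e2 := h1 a T z
      rw [← add_assoc]
      linarith
  intro S T
  -- Starting from `S ∩ T`, the increments `S \ T` and `T \ S` lead to `S`, `T` and, together, `S ∪
  -- T`.
  have e := h2 (S \ T) (T \ S) (∑ i ∈ S ∩ T, v i)
  have d1 : ∑ i ∈ S ∩ T, v i + ∑ i ∈ S \ T, v i = ∑ i ∈ S, v i := Finset.sum_inter_add_sum_sdiff S T v
  have d2 : ∑ i ∈ S ∩ T, v i + ∑ i ∈ T \ S, v i = ∑ i ∈ T, v i := by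
    rw [Finset.inter_comm]; exact Finset.sum_inter_add_sum_sdiff T S v
  rw [d2, d1] at e
  rwa [← Finset.sum_union Finset.disjoint_sdiff, Finset.union_sdiff_self_eq_union] at e

/-! ### A Chernoff bound by counting. -/

/-- The linear term disappears when this is averaged over a centred variable, leaving a
Gaussian-type factor. -/
theorem exp_le_add_exp_sq {y : ℝ} (hy : |y| ≤ 1) : Real.exp y ≤ y + Real.exp (y ^ 2) := by
  have h1 := (abs_le.mp (Real.abs_exp_sub_one_sub_id_le hy)).2
  have h2 := Real.add_one_le_exp (y ^ 2)
  linarith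

section Concentration

variable {ι κ : Type*} [Fintype ι] [Fintype κ] [DecidableEq ι]

/-- Exponential moments of a sum of independent centred bounded random variables. -/
theorem sum_exp_sum_le {z : ι → κ → ℝ} {t r : ℝ} (ht : 0 ≤ t) (htr : t * r ≤ 1)
    (hz0 : ∀ i, ∑ x, z i x = 0) (hzr : ∀ i x, |z i x| ≤ r) :
    ∑ σ : ι → κ, Real.exp (t * ∑ i, z i (σ i)) ≤
      Fintype.card (ι → κ) * Real.exp (Fintype.card ι * (t * r) ^ 2) := by
  calc _ = ∏ i, ∑ x, Real.exp (t * z i x) := by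
        rw [Fintype.prod_sum]
        refine Finset.sum_congr rfl fun σ _ => ?_
        rw [← Real.exp_sum, Finset.mul_sum]
    _ ≤ ∏ i : ι, (Fintype.card κ * Real.exp ((t * r) ^ 2)) := by
        refine Finset.prod_le_prod (fun i _ => Finset.sum_nonneg fun x _ => (Real.exp_pos _).le)
          fun i _ => ?_
        calc _ ≤ ∑ x, (t * z i x + Real.exp ((t * r) ^ 2)) := by
              refine Finset.sum_le_sum fun x _ => ?_
              have h : |t * z i x| ≤ t * r := by
                rw [abs_mul, abs_of_nonneg ht]; exact mul_le_mul_of_nonneg_left (hzr i x) ht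
              refine (exp_le_add_exp_sq (h.trans htr)).trans ?_
              have := sq_le_sq' (by linarith [(abs_le.mp h).1]) (abs_le.mp h).2
              gcongr
          _ = _ := by
              rw [Finset.sum_add_distrib, ← Finset.mul_sum, hz0]; simp
    _ = _ := by
        rw [Finset.prod_const, mul_pow, ← Real.exp_nat_mul, Finset.card_univ, Fintype.card_fun]
        push_cast; rfl

theorem card_lt_sum_le {z : ι → κ → ℝ} {t r : ℝ} (ht : 0 ≤ t) (htr : t * r ≤ 1)
    (hz0 : ∀ i, ∑ x, z i x = 0) (hzr : ∀ i x, |z i x| ≤ r) (b : ℝ) :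
    ((Finset.univ.filter fun σ : ι → κ => b < ∑ i, z i (σ i)).card : ℝ) ≤
      Fintype.card (ι → κ) * Real.exp (Fintype.card ι * (t * r) ^ 2 - t * b) := by
  have h := sum_exp_sum_le ht htr hz0 hzr
  have h1 : ((Finset.univ.filter fun σ : ι → κ => b < ∑ i, z i (σ i)).card : ℝ) *
      Real.exp (t * b) ≤ ∑ σ : ι → κ, Real.exp (t * ∑ i, z i (σ i)) := by
    rw [← nsmul_eq_mul, ← Finset.sum_const]
    refine (Finset.sum_le_sum fun σ hσ => ?_).trans
      (Finset.sum_le_sum_of_subset_of_nonneg (Finset.filter_subset _ _)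
        fun σ _ _ => (Real.exp_pos _).le)
    have := (Finset.mem_filter.mp hσ).2
    gcongr
  rw [Real.exp_sub, mul_div_assoc', le_div_iff₀ (Real.exp_pos _)]
  exact h1.trans h

theorem card_lt_abs_sum_le {z : ι → κ → ℝ} {t r : ℝ} (ht : 0 ≤ t) (htr : t * r ≤ 1)
    (hz0 : ∀ i, ∑ x, z i x = 0) (hzr : ∀ i x, |z i x| ≤ r) (b : ℝ) :
    ((Finset.univ.filter fun σ : ι → κ => b < |∑ i, z i (σ i)|).card : ℝ) ≤
      Fintype.card (ι → κ) * (2 * Real.exp (Fintype.card ι * (t * r) ^ 2 - t * b)) := by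
  classical
  have h1 := card_lt_sum_le ht htr hz0 hzr b
  have h2 := card_lt_sum_le (z := fun i x => -z i x) ht htr
    (fun i => by rw [Finset.sum_neg_distrib, hz0, neg_zero]) (fun i x => by simpa using hzr i x) b
  have h3 : (Finset.univ.filter fun σ : ι → κ => b < |∑ i, z i (σ i)|) ⊆
      (Finset.univ.filter fun σ : ι → κ => b < ∑ i, z i (σ i)) ∪
        (Finset.univ.filter fun σ : ι → κ => b < ∑ i, -z i (σ i)) := by
    intro σ hσ
    simpa [lt_abs] using hσ
  have h4 : ((Finset.univ.filter fun σ : ι → κ => b < |∑ i, z i (σ i)|).card : ℝ) ≤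
      ((Finset.univ.filter fun σ : ι → κ => b < ∑ i, z i (σ i)).card : ℝ) +
        (Finset.univ.filter fun σ : ι → κ => b < ∑ i, -z i (σ i)).card := by
    exact_mod_cast (Finset.card_le_card h3).trans (Finset.card_union_le _ _)
  linarith

end Concentration

/-! ### Indistinguishable instances and averaging over a hidden family. -/

namespace OracleAlgorithm

variable {n : ℕ}

open Classical in
/-- The value queries made by the algorithm on the instance `I`. -/
noncomputable def queries (I : MatroidBaseInstance n) :
    OracleAlgorithm n → List (Finset (Fin n))
  | .output _ => []
  | .value S next => S :: (next (I.f S)).queries I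
  | .member S ifYes ifNo => if I.Feasible S then ifYes.queries I else ifNo.queries I

theorem length_queries (I : MatroidBaseInstance n) (T : OracleAlgorithm n) :
    (T.queries I).length = T.valueQueries I := by
  induction T with
  | output S => rfl
  | value S next ih => simp [queries, valueQueries, ih]
  | member S y m ihy ihm =>
    simp only [queries, valueQueries]
    split_ifs
    · exact ihy
    · exact ihm

/-- An algorithm cannot tell apart two instances with the same matroid on which its value queries
have the same answers. -/
theorem result_eq_of_agree {I I' : MatroidBaseInstance n} (hm : I'.matroid = I.matroid)
    (T : OracleAlgorithm n) (h : ∀ S ∈ T.queries I, I'.f S = I.f S) :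
    T.result I' = T.result I := by
  have hF : ∀ S, I'.Feasible S ↔ I.Feasible S := fun S => by
    unfold MatroidBaseInstance.Feasible; rw [hm]
  induction T with
  | output S => rfl
  | value S next ih =>
    simp only [queries, List.mem_cons, forall_eq_or_imp] at h
    simp only [result, h.1]
    exact ih _ h.2
  | member S y m ihy ihm =>
    simp only [queries] at h
    by_cases hS : I.Feasible S
    · rw [if_pos hS] at h
      simpa only [result, if_pos hS, if_pos ((hF S).2 hS)] using ihy h
    · rw [if_neg hS] at h
      simpa only [result, if_neg hS, if_neg (mt (hF S).1 hS)] using ihm h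

end OracleAlgorithm

namespace RandomizedAlgorithm

variable {n : ℕ} (A : RandomizedAlgorithm.{u} n)

theorem measurable_comp_result (I : MatroidBaseInstance n) (F : Finset (Fin n) → ℝ) :
    Measurable fun ω => F ((A.alg ω).result I) := by
  let _ : MeasurableSpace (Finset (Fin n)) := ⊤
  have h : Measurable fun ω => (A.alg ω).result I :=
    measurable_to_countable' fun S => A.measurableSet_result I S
  exact (measurable_from_top (f := F)).comp h

theorem integrable_comp_result (I : MatroidBaseInstance n) (F : Finset (Fin n) → ℝ) :
    Integrable (fun ω => F ((A.alg ω).result I)) A.μ := by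
  refine Integrable.of_bound (A.measurable_comp_result I F).aestronglyMeasurable
    (∑ S, |F S|) (Filter.Eventually.of_forall fun ω => ?_)
  exact Finset.single_le_sum (f := fun S => |F S|) (fun S _ => abs_nonneg _) (Finset.mem_univ _)

theorem measurable_valueQueries (I : MatroidBaseInstance n) :
    Measurable fun ω => (A.alg ω).valueQueries I :=
  measurable_to_countable' fun q => A.measurableSet_valueQueries I q

theorem integral_valueQueries (I : MatroidBaseInstance n) :
    ∫ ω, ((A.alg ω).valueQueries I : ℝ) ∂A.μ = (A.expectedValueQueries I).toReal := by
  rw [integral_eq_lintegral_of_nonneg_ae (Filter.Eventually.of_forall fun ω => Nat.cast_nonneg _)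
    (measurable_from_top.comp (A.measurable_valueQueries I)).aestronglyMeasurable]
  simp [expectedValueQueries]

theorem integrable_valueQueries {I : MatroidBaseInstance n} (h : A.expectedValueQueries I ≠ ⊤) :
    Integrable (fun ω => ((A.alg ω).valueQueries I : ℝ)) A.μ := by
  refine ⟨(measurable_from_top.comp (A.measurable_valueQueries I)).aestronglyMeasurable, ?_⟩
  rw [hasFiniteIntegral_iff_ofReal (Filter.Eventually.of_forall fun ω => Nat.cast_nonneg _)]
  simpa [expectedValueQueries, lt_top_iff_ne_top] using h

/-- If a family of instances with the same matroid is hard to tell apart from `g`, then on average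
over the family the algorithm does not do much better than the best value of `g`. -/
theorem sum_expectedValue_le {ι : Type*} [Fintype ι] (g : MatroidBaseInstance n)
    (f : ι → MatroidBaseInstance n) (hm : ∀ i, (f i).matroid = g.matroid) {β V ρ : ℝ}
    (hβ0 : 0 ≤ β) (hV0 : 0 ≤ V) (hρ0 : 0 ≤ ρ) (hβ : ∀ S, g.Feasible S → g.f S ≤ β)
    (hV : ∀ i S, (f i).Feasible S → (f i).f S ≤ V)
    (hρ : ∀ S, ((Finset.univ.filter fun i => (f i).f S ≠ g.f S).card : ℝ) ≤ Fintype.card ι * ρ)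
    (hQ : A.expectedValueQueries g ≠ ⊤) :
    ∑ i, A.expectedValue (f i) ≤
      Fintype.card ι * (β + V * ρ * ((A.expectedValueQueries g).toReal + 1)) := by
  classical
  have hpt : ∀ ω, ∑ i, (if (f i).Feasible ((A.alg ω).result (f i))
      then (f i).f ((A.alg ω).result (f i)) else 0) ≤
      Fintype.card ι * (β + V * ρ * ((A.alg ω).valueQueries g + 1)) := by
    intro ω
    set T := A.alg ω
    -- The returned set is listed with the queries, so that its value too is the one under `g`; this
    -- accounts for the `+ 1`.
    set l := T.result g :: T.queries g with hl
    set bad := Finset.univ.filter fun i => ∃ S ∈ l, (f i).f S ≠ g.f S with hbad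
    have hcard : (bad.card : ℝ) ≤ Fintype.card ι * ρ * (T.valueQueries g + 1) := by
      have hsub : bad ⊆ l.toFinset.biUnion fun S => Finset.univ.filter fun i =>
          (f i).f S ≠ g.f S := by
        intro i hi
        simpa [hbad] using hi
      calc (bad.card : ℝ) ≤ ∑ S ∈ l.toFinset, ((Finset.univ.filter fun i =>
            (f i).f S ≠ g.f S).card : ℝ) := by
            exact_mod_cast (Finset.card_le_card hsub).trans Finset.card_biUnion_le
        _ ≤ ∑ S ∈ l.toFinset, (Fintype.card ι * ρ : ℝ) := Finset.sum_le_sum fun S _ => hρ S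
        _ = l.toFinset.card * (Fintype.card ι * ρ : ℝ) := by simp
        _ ≤ (T.valueQueries g + 1) * (Fintype.card ι * ρ : ℝ) := by
            have h1 := l.toFinset_card_le
            rw [hl, List.length_cons, OracleAlgorithm.length_queries, ← hl] at h1
            gcongr
            exact_mod_cast h1
        _ = _ := by ring
    have hi : ∀ i, (if (f i).Feasible (T.result (f i)) then (f i).f (T.result (f i)) else 0) ≤
        β + V * (if i ∈ bad then 1 else 0) := by
      intro i
      by_cases hb : i ∈ bad
      · rw [if_pos hb]
        split_ifs with hF
        · have := hV i _ hF
          linarith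
        · linarith
      · rw [if_neg hb]
        have hag : ∀ S ∈ l, (f i).f S = g.f S := by
          simpa [hbad] using hb
        rw [OracleAlgorithm.result_eq_of_agree (hm i) T fun S hS =>
          hag S (List.mem_cons_of_mem _ hS), hag _ List.mem_cons_self]
        split_ifs with hF
        · have : g.Feasible (T.result g) := by
            unfold MatroidBaseInstance.Feasible at hF ⊢; rwa [hm] at hF
          simpa using hβ _ this
        · simpa using hβ0
    calc _ ≤ ∑ i, (β + V * (if i ∈ bad then 1 else 0)) := Finset.sum_le_sum fun i _ => hi i
      _ = Fintype.card ι * β + V * bad.card := by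
          rw [Finset.sum_add_distrib, ← Finset.mul_sum]; simp
      _ ≤ Fintype.card ι * β + V * (Fintype.card ι * ρ * (T.valueQueries g + 1)) := by gcongr
      _ = _ := by ring
  have hint : ∀ i, Integrable (fun ω => if (f i).Feasible ((A.alg ω).result (f i))
      then (f i).f ((A.alg ω).result (f i)) else 0) A.μ := fun i =>
    A.integrable_comp_result (f i) fun S => if (f i).Feasible S then (f i).f S else 0
  have hq := A.integrable_valueQueries hQ
  unfold expectedValue
  rw [← integral_finsetSum _ fun i _ => hint i]
  have hlin : (fun ω => (Fintype.card ι : ℝ) * (β + V * ρ * ((A.alg ω).valueQueries g + 1))) =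
      fun ω => Fintype.card ι * (β + V * ρ) +
        Fintype.card ι * (V * ρ) * ((A.alg ω).valueQueries g : ℝ) := by
    funext ω; ring
  have hR := (integrable_const (μ := A.μ) (Fintype.card ι * (β + V * ρ))).add
    (hq.const_mul (Fintype.card ι * (V * ρ)))
  refine (integral_mono (integrable_finsetSum _ fun i _ => hint i) (hlin ▸ hR) hpt).trans_eq ?_
  rw [hlin, integral_add (integrable_const _) (hq.const_mul _), integral_const_mul,
    integral_const_mul,
    A.integral_valueQueries]
  simp only [integral_const, probReal_univ, smul_eq_mul]
  ring

end RandomizedAlgorithm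

/-! ### The matroid. -/

/-- The partition matroid on `Fin n` whose bases consist of `r` elements of `A` and `s` elements
of `B`. -/
noncomputable def twoBlockMatroid {n : ℕ} (A B : Finset (Fin n)) (r s : ℕ) (hAB : Disjoint A B)
    (hr : r ≤ A.card) (hs : s ≤ B.card) : Matroid (Fin n) :=
  Matroid.ofIsBaseOfFinite (E := Set.univ) Set.finite_univ
    (fun C => C ⊆ A ∪ B ∧ (C ∩ A).ncard = r ∧ (C ∩ B).ncard = s)
    (by
      obtain ⟨A', hA', hr'⟩ := Finset.exists_subset_card_eq hr
      obtain ⟨B', hB', hs'⟩ := Finset.exists_subset_card_eq hs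
      refine ⟨((A' ∪ B' : Finset (Fin n)) : Set (Fin n)), ?_, ?_, ?_⟩
      · rw [← Finset.coe_union, Finset.coe_subset]
        exact Finset.union_subset_union hA' hB'
      · rw [← Finset.coe_inter, Set.ncard_coe_finset, Finset.union_inter_distrib_right,
          Finset.inter_eq_left.2 hA',
          Finset.disjoint_iff_inter_eq_empty.1 (hAB.symm.mono_left hB'), Finset.union_empty, hr']
      · rw [← Finset.coe_inter, Set.ncard_coe_finset, Finset.union_inter_distrib_right,
          Finset.inter_eq_left.2 hB',
          Finset.disjoint_iff_inter_eq_empty.1 (hAB.mono_left hA'), Finset.empty_union, hs'])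
    (by
      have hd : ∀ i, i ∈ A → i ∉ B := fun _ hi => Finset.disjoint_left.1 hAB hi
      -- Exchange within one block: equal counts in `D` provide a `y` in the same block as `x`, and
      -- the other block is not touched.
      have key : ∀ (X Y : Set (Fin n)) (D D' : Finset (Fin n)), (∀ i, i ∈ D → i ∉ D') →
          (X ∩ D).ncard = (Y ∩ D).ncard → ∀ x ∈ X \ Y, x ∈ D → ∃ y ∈ Y \ X, y ∈ D ∧
            (insert y (X \ {x}) ∩ D).ncard = (X ∩ D).ncard ∧ insert y (X \ {x}) ∩ D' = X ∩ D' := by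
        intro X Y D D' hDD' hcard x hx hxD
        obtain ⟨y, hy, hyX⟩ : ∃ y ∈ Y ∩ D, y ∉ X ∩ D := by
          by_contra! hcon
          have : Y ∩ D = X ∩ D := Set.eq_of_subset_of_ncard_le hcon hcard.le (Set.toFinite _)
          exact hx.2 (this.symm ▸ (⟨hx.1, hxD⟩ : x ∈ X ∩ D) : x ∈ Y ∩ D).1
        refine ⟨y, ⟨hy.1, fun h => hyX ⟨h, hy.2⟩⟩, hy.2, ?_, ?_⟩
        · rw [← Set.ncard_exchange hyX (⟨hx.1, hxD⟩ : x ∈ X ∩ D)]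
          congr 1
          ext i
          have := hy.2
          simp only [Set.mem_inter_iff, Set.mem_insert_iff, Set.mem_sdiff, Set.mem_singleton_iff]
          constructor
          · tauto
          · rintro (rfl | h)
            · exact ⟨Or.inl rfl, this⟩
            · tauto
        · ext i
          simp only [Set.mem_inter_iff, Set.mem_insert_iff, Set.mem_sdiff, Set.mem_singleton_iff]
          constructor
          · rintro ⟨rfl | h, h'⟩
            · exact absurd h' (hDD' _ hy.2)
            · exact ⟨h.1, h'⟩
          · rintro ⟨h, h'⟩
            exact ⟨Or.inr ⟨h, fun hix => hDD' _ hxD (hix ▸ h')⟩, h'⟩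
      rintro X Y ⟨hX, hXA, hXB⟩ ⟨hY, hYA, hYB⟩ x hx
      have hsub : ∀ y ∈ Y, insert y (X \ {x}) ⊆ (A ∪ B : Set (Fin n)) := fun y hy =>
        Set.insert_subset (hY hy) (Set.sdiff_subset.trans hX)
      rcases hX hx.1 with hxA | hxB
      · obtain ⟨y, hy, -, h1, h2⟩ := key X Y A B hd (hXA.trans hYA.symm) x hx hxA
        exact ⟨y, hy, hsub y hy.1, h1.trans hXA, by rw [h2, hXB]⟩
      · obtain ⟨y, hy, -, h1, h2⟩ := key X Y B A (fun i hi hi' => hd i hi' hi)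
          (hXB.trans hYB.symm) x hx hxB
        exact ⟨y, hy, hsub y hy.1, by rw [h2, hXA], h1.trans hXB⟩)
    (fun _ _ => Set.subset_univ _)

theorem twoBlockMatroid_isBase_coe {n : ℕ} {A B : Finset (Fin n)} {r s : ℕ} (hAB : Disjoint A B)
    (hr : r ≤ A.card) (hs : s ≤ B.card) (S : Finset (Fin n)) :
    (twoBlockMatroid A B r s hAB hr hs).IsBase S ↔
      S ⊆ A ∪ B ∧ (S ∩ A).card = r ∧ (S ∩ B).card = s := by
  change ((S : Set (Fin n)) ⊆ A ∪ B ∧ ((S : Set (Fin n)) ∩ A).ncard = r ∧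
    ((S : Set (Fin n)) ∩ B).ncard = s) ↔ _
  simp only [← Finset.coe_inter, ← Finset.coe_union, Set.ncard_coe_finset, Finset.coe_subset]

/-! ### The objective: submodularity, nonnegativity, values on bases. -/

/-- Functions on `ℤ × ℤ` which may be added to the symmetric objective `cutObjective K N 0`
without destroying nonnegativity and submodularity. -/
structure IsMild (K : ℕ) (Ψ : ℤ → ℤ → ℝ) : Prop where
  symm : ∀ p q, Ψ p q = Ψ q p
  second_diff_le : ∀ p q σ τ : ℤ, |σ| ≤ K → |τ| ≤ K →
    Ψ (p + σ + τ) q - Ψ (p + σ) q - Ψ (p + τ) q + Ψ p q ≤ 1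
  mixed_diff_le : ∀ p q σ τ : ℤ,
    Ψ (p + σ) (q + τ) - Ψ (p + σ) q - Ψ p (q + τ) + Ψ p q ≤ max 0 (σ * τ : ℤ)
  min_le : ∀ p q : ℤ, min 0 ((p : ℝ) * q) ≤ Ψ p q

theorem isMild_zero (K : ℕ) : IsMild K fun _ _ => 0 where
  symm _ _ := rfl
  second_diff_le _ _ _ _ _ _ := by norm_num
  mixed_diff_le _ _ _ _ := by simp
  min_le _ _ := min_le_left _ _

theorem isMild_flatProd {K : ℕ} {s : Finset ℕ} {w : ℕ → ℝ} {η : ℝ} (hw0 : ∀ j ∈ s, 0 ≤ w j)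
    (hw1 : ∑ j ∈ s, w j = 1) (hw : ∀ j ∈ s, w j * j ≤ η) (hη : 0 ≤ η) (hηK : η * (K * K) ≤ 1) :
    IsMild K (flatProd s w) where
  symm := flatProd_comm s w
  second_diff_le p q σ τ hσ hτ := by
    have h := abs_second_diff_le (φ := fun x => flatProd s w x q)
      (fun x => abs_flatProd_second_diff_le hw0 hw hη x q) p σ τ
    refine ((le_abs_self _).trans h).trans (le_trans ?_ hηK)
    have h1 : ((|σ| * |τ| : ℤ) : ℝ) ≤ K * K := by
      exact_mod_cast mul_le_mul hσ hτ (abs_nonneg _) (by positivity)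
    exact mul_le_mul_of_nonneg_left h1 hη
  mixed_diff_le p q σ τ := flatProd_mixed_diff_le hw0 hw1 p q σ τ
  min_le := min_le_flatProd hw0 hw1

/-- The objective in terms of `(x, p, y, q)`: the numbers `x`, `y` of chosen elements in the two
blocks of size `N`, and the imbalances `p`, `q` of the choice inside the two blocks. -/
noncomputable def cutObjective (K : ℕ) (N : ℝ) (Ψ : ℤ → ℤ → ℝ) (z : ℤ × ℤ × ℤ × ℤ) : ℝ :=
  K * z.1 * (N - z.2.2.1) + Ψ z.2.1 z.2.2.2 + (z.1 * (N - z.1) + z.2.2.1 * (N - z.2.2.1)) / 2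

section cutObjective

variable {K : ℕ} {N : ℝ} {Ψ : ℤ → ℤ → ℝ}

/-- The term `x * (N - x) / 2` has second difference `-1`, which pays for that of `Ψ`. -/
theorem cutObjective_step_left (h : IsMild K Ψ) {σ τ : ℤ} (hσ : |σ| ≤ K) (hτ : |τ| ≤ K)
    (z : ℤ × ℤ × ℤ × ℤ) :
    cutObjective K N Ψ (z + (1, σ, 0, 0) + (1, τ, 0, 0)) + cutObjective K N Ψ z ≤
      cutObjective K N Ψ (z + (1, σ, 0, 0)) + cutObjective K N Ψ (z + (1, τ, 0, 0)) := by
  obtain ⟨x, p, y, q⟩ := z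
  have := h.second_diff_le p q σ τ hσ hτ
  simp only [cutObjective, Prod.mk_add_mk, add_zero]
  push_cast
  linarith

theorem cutObjective_step_right (h : IsMild K Ψ) {σ τ : ℤ} (hσ : |σ| ≤ K) (hτ : |τ| ≤ K)
    (z : ℤ × ℤ × ℤ × ℤ) :
    cutObjective K N Ψ (z + (0, 0, 1, σ) + (0, 0, 1, τ)) + cutObjective K N Ψ z ≤
      cutObjective K N Ψ (z + (0, 0, 1, σ)) + cutObjective K N Ψ (z + (0, 0, 1, τ)) := by
  obtain ⟨x, p, y, q⟩ := z
  have := h.second_diff_le q p σ τ hσ hτ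
  simp only [h.symm _ p] at this
  simp only [cutObjective, Prod.mk_add_mk, add_zero]
  push_cast
  linarith

/-- The term `K * x * (N - y)` has mixed difference `-K`, which pays for that of `Ψ`. -/
theorem cutObjective_step_mixed (h : IsMild K Ψ) {σ τ : ℤ} (hστ : σ * τ ≤ K)
    (z : ℤ × ℤ × ℤ × ℤ) :
    cutObjective K N Ψ (z + (1, σ, 0, 0) + (0, 0, 1, τ)) + cutObjective K N Ψ z ≤
      cutObjective K N Ψ (z + (1, σ, 0, 0)) + cutObjective K N Ψ (z + (0, 0, 1, τ)) := by
  obtain ⟨x, p, y, q⟩ := z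
  have h1 := h.mixed_diff_le p q σ τ
  have h2 : max 0 ((σ * τ : ℤ) : ℝ) ≤ K :=
    max_le (Nat.cast_nonneg _) (by exact_mod_cast hστ)
  simp only [cutObjective, Prod.mk_add_mk, add_zero]
  push_cast at *
  linarith

end cutObjective

/-- Two disjoint blocks `A`, `B` of `(K + 1) * a` elements of `Fin n` with distinguished parts
`A₁`, `B₁` of `a` elements. -/
structure HiddenBlocks (n K a : ℕ) where
  A : Finset (Fin n)
  B : Finset (Fin n)
  A₁ : Finset (Fin n)
  B₁ : Finset (Fin n)
  disjoint : Disjoint A B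
  subset_A : A₁ ⊆ A
  subset_B : B₁ ⊆ B
  card_A : A.card = (K + 1) * a
  card_B : B.card = (K + 1) * a
  card_A₁ : A₁.card = a
  card_B₁ : B₁.card = a

namespace HiddenBlocks

variable {n K a : ℕ} (D : HiddenBlocks n K a)

/-- The contribution of an element to `(x, p, y, q)`. -/
def step (i : Fin n) : ℤ × ℤ × ℤ × ℤ :=
  (if i ∈ D.A then 1 else 0,
    (K + 1) * (if i ∈ D.A₁ then 1 else 0) - (if i ∈ D.A then 1 else 0),
    if i ∈ D.B then 1 else 0,
    -- The sign is opposite to that in `A`: a product of a step in `A` and a step in `B` is then at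
    -- most `K` rather than `K ^ 2`, and both imbalances are positive at the optimum.
    (if i ∈ D.B then 1 else 0) - (K + 1) * (if i ∈ D.B₁ then 1 else 0))

theorem step_cases (i : Fin n) :
    D.step i = 0 ∨ (∃ σ : ℤ, D.step i = (1, σ, 0, 0) ∧ (σ = K ∨ σ = -1)) ∨
      ∃ σ : ℤ, D.step i = (0, 0, 1, σ) ∧ (σ = -K ∨ σ = 1) := by
  have hd : i ∈ D.A → i ∉ D.B := fun h => Finset.disjoint_left.1 D.disjoint h
  have hA := @D.subset_A i
  have hB := @D.subset_B i
  unfold step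
  by_cases h1 : i ∈ D.A
  · have h2 := hd h1
    have h3 : i ∉ D.B₁ := fun h => h2 (hB h)
    refine Or.inr (Or.inl ?_)
    by_cases h4 : i ∈ D.A₁ <;> simp [h1, h2, h3, h4]
  · have h2 : i ∉ D.A₁ := fun h => h1 (hA h)
    by_cases h3 : i ∈ D.B
    · refine Or.inr (Or.inr ?_)
      by_cases h4 : i ∈ D.B₁ <;> simp [h1, h2, h3, h4]
    · have h4 : i ∉ D.B₁ := fun h => h3 (hB h)
      left; simp [h1, h2, h3, h4]

/-- The imbalance of `S` inside the block `A`. -/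
def imbalanceA (S : Finset (Fin n)) : ℤ := (K + 1) * (S ∩ D.A₁).card - (S ∩ D.A).card

/-- The imbalance of `S` inside the block `B`. -/
def imbalanceB (S : Finset (Fin n)) : ℤ := (S ∩ D.B).card - (K + 1) * (S ∩ D.B₁).card

theorem sum_step (S : Finset (Fin n)) :
    ∑ i ∈ S, D.step i =
      (((S ∩ D.A).card : ℤ), D.imbalanceA S, ((S ∩ D.B).card : ℤ), D.imbalanceB S) := by
  have h : ∀ C : Finset (Fin n), ∑ i ∈ S, (if i ∈ C then (1 : ℤ) else 0) = (S ∩ C).card := by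
    intro C
    rw [Finset.sum_boole, Finset.filter_mem_eq_inter]
  ext <;> simp only [step, Prod.fst_sum, Prod.snd_sum, Finset.sum_sub_distrib, ← Finset.mul_sum, h,
    imbalanceA, imbalanceB]

/-- The objective function on sets. -/
noncomputable def objective (Ψ : ℤ → ℤ → ℝ) (S : Finset (Fin n)) : ℝ :=
  cutObjective K ((K + 1) * a) Ψ (∑ i ∈ S, D.step i)

theorem objective_eq (Ψ : ℤ → ℤ → ℝ) (S : Finset (Fin n)) :
    D.objective Ψ S = K * (S ∩ D.A).card * ((K + 1) * a - (S ∩ D.B).card) +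
      Ψ (D.imbalanceA S) (D.imbalanceB S) + ((S ∩ D.A).card * ((K + 1) * a - (S ∩ D.A).card) +
        (S ∩ D.B).card * ((K + 1) * a - (S ∩ D.B).card)) / 2 := by
  simp only [objective, sum_step, cutObjective, Int.cast_natCast]

theorem submodular_objective (hK : 1 ≤ K) {Ψ : ℤ → ℤ → ℝ} (h : IsMild K Ψ) :
    SubmodularSetFunction (D.objective Ψ) := by
  have hK' : (1 : ℤ) ≤ K := by exact_mod_cast hK
  refine submodular_of_steps (cutObjective K ((K + 1) * a) Ψ) D.step fun i j z => ?_
  rcases D.step_cases i with hi | ⟨σ, hi, hσ⟩ | ⟨σ, hi, hσ⟩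
  · rw [hi]; simp [add_comm]
  all_goals
    have hσ' : |σ| ≤ K := by rw [abs_le]; omega
    rcases D.step_cases j with hj | ⟨τ, hj, hτ⟩ | ⟨τ, hj, hτ⟩
    · rw [hj]; simp
    all_goals
      have hτ' : |τ| ≤ K := by rw [abs_le]; omega
      rw [hi, hj]
  · exact cutObjective_step_left h hσ' hτ' z
  · refine cutObjective_step_mixed h ?_ z
    -- The possible products are `-K ^ 2`, `K`, `K` and `-1`.
    rcases hσ with rfl | rfl <;> rcases hτ with rfl | rfl <;> nlinarith
  · have := cutObjective_step_mixed (N := (K + 1) * a) h (σ := τ) (τ := σ) (by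
      rcases hσ with rfl | rfl <;> rcases hτ with rfl | rfl <;> nlinarith) z
    rw [add_right_comm, add_comm (cutObjective _ _ _ (z + (0, 0, 1, σ)))]
    exact this
  · exact cutObjective_step_right h hσ' hτ' z

/-- Since `Ψ` is at least `0` or at least `p * q`, the first two terms dominate either the symmetric
cut or the hidden cut, and both are nonnegative. -/
theorem objective_nonneg {Ψ : ℤ → ℤ → ℝ} (h : IsMild K Ψ) (S : Finset (Fin n)) :
    0 ≤ D.objective Ψ S := by
  have key : ∀ C C₁ : Finset (Fin n), C₁ ⊆ C → C.card = (K + 1) * a → C₁.card = a →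
      ∃ u v : ℝ, 0 ≤ u ∧ u ≤ a ∧ 0 ≤ v ∧ v ≤ K * a ∧ ((S ∩ C₁).card : ℝ) = u ∧
        ((S ∩ C).card : ℝ) = u + v := by
    intro C C₁ hs hC hC₁
    refine ⟨(S ∩ C₁).card, (S ∩ (C \ C₁)).card, by positivity, ?_, by positivity, ?_, rfl, ?_⟩
    · exact_mod_cast (Finset.card_le_card Finset.inter_subset_right).trans hC₁.le
    · have h1 : (S ∩ (C \ C₁)).card ≤ (C \ C₁).card := Finset.card_le_card Finset.inter_subset_right
      rw [Finset.card_sdiff_of_subset hs, hC, hC₁, add_mul, one_mul, Nat.add_sub_cancel] at h1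
      exact_mod_cast h1
    · rw [← Nat.cast_add, ← Finset.card_union_of_disjoint, ← Finset.inter_union_distrib_left,
        Finset.union_sdiff_of_subset hs]
      exact Finset.disjoint_sdiff.mono Finset.inter_subset_right Finset.inter_subset_right
  obtain ⟨u, v, hu, hu', hv, hv', e1, e2⟩ := key D.A D.A₁ D.subset_A D.card_A D.card_A₁
  obtain ⟨u', v', hu1, hu1', hv1, hv1', e1', e2'⟩ := key D.B D.B₁ D.subset_B D.card_B D.card_B₁
  have hmin := h.min_le (D.imbalanceA S) (D.imbalanceB S)
  rw [objective_eq]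
  have hP : (D.imbalanceA S : ℝ) = K * u - v := by
    unfold imbalanceA; push_cast; rw [e1, e2]; ring
  have hQ : (D.imbalanceB S : ℝ) = v' - K * u' := by
    unfold imbalanceB; push_cast; rw [e1', e2']; ring
  rw [hP, hQ] at hmin
  rw [e2, e2']
  have hK : (0 : ℝ) ≤ K := K.cast_nonneg
  have t1 : 0 ≤ (u + v) * ((K + 1) * a - (u + v)) :=
    mul_nonneg (by linarith) (by linarith)
  have t2 : 0 ≤ (u' + v') * ((K + 1) * a - (u' + v')) :=
    mul_nonneg (by linarith) (by linarith)
  have t3 : 0 ≤ K * (u + v) * ((K + 1) * a - (u' + v')) :=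
    mul_nonneg (by positivity) (by linarith)
  -- With `u`, `v` elements of `S` inside and outside `A₁`, and `u'`, `v'` likewise for `B₁`, this
  -- is the hidden cut: weight `K * (K + 1)` from `A₁` to `B₁`, weight `K + 1` between the
  -- complements.
  have t4 : 0 ≤ K * (u + v) * ((K + 1) * a - (u' + v')) + (K * u - v) * (v' - K * u') := by
    have : K * (u + v) * ((K + 1) * a - (u' + v')) + (K * u - v) * (v' - K * u') =
        K * (K + 1) * (u * (a - u')) + (K + 1) * (v * (K * a - v')) := by ring
    rw [this]
    have := mul_nonneg hu (sub_nonneg.2 hu1')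
    have := mul_nonneg hv (sub_nonneg.2 hv1')
    positivity
  rcases min_le_iff.1 hmin with hm | hm <;> linarith

theorem le_card_A : a ≤ D.A.card := by
  rw [D.card_A]; exact Nat.le_mul_of_pos_left a K.succ_pos

theorem le_card_B : K * a ≤ D.B.card := by
  rw [D.card_B]; exact Nat.mul_le_mul_right a K.le_succ

/-- The instance with objective function `D.objective Ψ` whose bases consist of `a` elements of
`A` and `K * a` elements of `B`. -/
noncomputable def toInstance (hK : 1 ≤ K) {Ψ : ℤ → ℤ → ℝ} (h : IsMild K Ψ) :
    MatroidBaseInstance n where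
  matroid := twoBlockMatroid D.A D.B a (K * a) D.disjoint
    D.le_card_A D.le_card_B
  ground_eq := rfl
  f := D.objective Ψ
  nonneg := D.objective_nonneg h
  submodular := D.submodular_objective hK h

variable (hK : 1 ≤ K) {Ψ : ℤ → ℤ → ℝ} (h : IsMild K Ψ)

theorem feasible_iff (S : Finset (Fin n)) : (D.toInstance hK h).Feasible S ↔
    S ⊆ D.A ∪ D.B ∧ (S ∩ D.A).card = a ∧ (S ∩ D.B).card = K * a :=
  twoBlockMatroid_isBase_coe D.disjoint D.le_card_A D.le_card_B S

theorem objective_eq_of_feasible {S : Finset (Fin n)} (hS : (D.toInstance hK h).Feasible S) :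
    D.objective Ψ S = 2 * K * a ^ 2 + Ψ (D.imbalanceA S) (D.imbalanceB S) := by
  obtain ⟨-, h1, h2⟩ := (D.feasible_iff hK h S).1 hS
  rw [objective_eq, h1, h2]
  push_cast; ring

theorem abs_imbalance_mul_le {S : Finset (Fin n)} (hS : (D.toInstance hK h).Feasible S) :
    |(D.imbalanceA S : ℝ) * D.imbalanceB S| ≤ K ^ 2 * a ^ 2 := by
  obtain ⟨-, h1, h2⟩ := (D.feasible_iff hK h S).1 hS
  have hA : (S ∩ D.A₁).card ≤ a :=
    (Finset.card_le_card Finset.inter_subset_right).trans D.card_A₁.le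
  have hB : (S ∩ D.B₁).card ≤ a :=
    (Finset.card_le_card Finset.inter_subset_right).trans D.card_B₁.le
  have hP : |D.imbalanceA S| ≤ K * a := by
    unfold imbalanceA; rw [h1, abs_le]; constructor <;> nlinarith
  have hQ : |D.imbalanceB S| ≤ K * a := by
    unfold imbalanceB; rw [h2, abs_le]; push_cast; constructor <;> nlinarith
  have hP' : |(D.imbalanceA S : ℝ)| ≤ K * a := by exact_mod_cast hP
  have hQ' : |(D.imbalanceB S : ℝ)| ≤ K * a := by exact_mod_cast hQ
  calc _ ≤ ((K : ℝ) * a) * (K * a) := by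
        rw [abs_mul]; exact mul_le_mul hP' hQ' (abs_nonneg _) (by positivity)
    _ = _ := by ring

/-- The base made of the distinguished part of `A` and the rest of `B`. -/
def optimum : Finset (Fin n) := D.A₁ ∪ D.B \ D.B₁

theorem optimum_inter : D.optimum ∩ D.A = D.A₁ ∧ D.optimum ∩ D.A₁ = D.A₁ ∧
    D.optimum ∩ D.B = D.B \ D.B₁ ∧ D.optimum ∩ D.B₁ = ∅ := by
  have hd : ∀ i, i ∈ D.A → i ∉ D.B := fun _ hi => Finset.disjoint_left.1 D.disjoint hi
  have hA := D.subset_A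
  have hB := D.subset_B
  unfold optimum
  refine ⟨?_, ?_, ?_, ?_⟩ <;> ext i <;>
    simp only [Finset.mem_inter, Finset.mem_union, Finset.mem_sdiff, Finset.notMem_empty] <;>
    have := hd i <;> have := @hA i <;> have := @hB i <;> tauto

theorem card_B_sdiff : (D.B \ D.B₁).card = K * a := by
  rw [Finset.card_sdiff_of_subset D.subset_B, D.card_B, D.card_B₁, add_mul, one_mul,
    Nat.add_sub_cancel]

theorem feasible_optimum : (D.toInstance hK h).Feasible D.optimum := by
  rw [feasible_iff, D.optimum_inter.1, D.optimum_inter.2.2.1]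
  exact ⟨Finset.union_subset_union D.subset_A Finset.sdiff_subset, D.card_A₁, D.card_B_sdiff⟩

theorem imbalance_optimum :
    D.imbalanceA D.optimum = (K * a : ℕ) ∧ D.imbalanceB D.optimum = (K * a : ℕ) := by
  obtain ⟨h1, h2, h3, h4⟩ := D.optimum_inter
  unfold imbalanceA imbalanceB
  rw [h1, h2, h3, h4, D.card_B_sdiff, D.card_A₁]
  constructor
  · push_cast; ring
  · simp

end HiddenBlocks

/-! ### Random transversals as hidden parts. -/

section Transversal

variable {n K a : ℕ}

/-- The elements with labels in `Fin a × Fin (K + 1)` chosen by `σ`. -/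
def transversal (e : Fin a × Fin (K + 1) ↪ Fin n) (σ : Fin a → Fin (K + 1)) : Finset (Fin n) :=
  Finset.univ.map ⟨fun i => e (i, σ i), fun i j h => by
    simpa using congrArg Prod.fst (e.injective h)⟩

theorem card_inter_transversal (e : Fin a × Fin (K + 1) ↪ Fin n) (σ : Fin a → Fin (K + 1))
    (S : Finset (Fin n)) :
    (S ∩ transversal e σ).card = ∑ i, if e (i, σ i) ∈ S then 1 else 0 := by
  rw [Finset.inter_comm, ← Finset.filter_mem_eq_inter, transversal, Finset.filter_map,
    Finset.card_map, Finset.card_filter]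
  rfl

theorem card_inter_map_univ (e : Fin a × Fin (K + 1) ↪ Fin n) (S : Finset (Fin n)) :
    (S ∩ Finset.univ.map e).card = ∑ i, ∑ x, if e (i, x) ∈ S then 1 else 0 := by
  rw [Finset.inter_comm, ← Finset.filter_mem_eq_inter, Finset.filter_map,
    Finset.card_map, Finset.card_filter, Fintype.sum_prod_type]
  rfl

/-- A random transversal meets every set in about the expected number of elements. -/
theorem card_imbalance_transversal_le (e : Fin a × Fin (K + 1) ↪ Fin n) (S : Finset (Fin n))
    (b : ℝ) {t : ℝ} (ht : 0 ≤ t) (htK : t * (K + 1) ≤ 1) :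
    ((Finset.univ.filter fun σ : Fin a → Fin (K + 1) =>
      b < |((K : ℝ) + 1) * (S ∩ transversal e σ).card - (S ∩ Finset.univ.map e).card|).card : ℝ) ≤
      Fintype.card (Fin a → Fin (K + 1)) *
        (2 * Real.exp (a * (t * (K + 1)) ^ 2 - t * b)) := by
  -- The imbalance is a sum of one term per group of `K + 1` elements; each term depends on one
  -- coordinate of `σ` and has mean zero.
  set z : Fin a → Fin (K + 1) → ℝ := fun i x =>
    (K + 1) * (if e (i, x) ∈ S then 1 else 0) - ∑ y, if e (i, y) ∈ S then 1 else 0 with hz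
  have h0 : ∀ i, ∑ x, z i x = 0 := fun i => by
    simp only [hz]
    rw [Finset.sum_sub_distrib, ← Finset.mul_sum, Finset.sum_const, Finset.card_univ,
      Fintype.card_fin]
    simp
  have h1 : ∀ i x, |z i x| ≤ (K + 1 : ℝ) := fun i x => by
    have hs0 : (0 : ℝ) ≤ ∑ y, if e (i, y) ∈ S then (1 : ℝ) else 0 :=
      Finset.sum_nonneg fun y _ => by split_ifs <;> norm_num
    have hs1 : ∑ y, (if e (i, y) ∈ S then (1 : ℝ) else 0) ≤ K + 1 := by
      calc _ ≤ ∑ _y : Fin (K + 1), (1 : ℝ) :=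
            Finset.sum_le_sum fun y _ => by split_ifs <;> norm_num
        _ = _ := by simp
    simp only [hz]
    rw [abs_le]
    split_ifs <;> constructor <;> linarith
  have h2 := card_lt_abs_sum_le ht htK h0 h1 b
  rw [Fintype.card_fin a] at h2
  convert h2 using 6 with σ
  rw [card_inter_transversal, card_inter_map_univ]
  simp only [hz]
  push_cast
  rw [Finset.sum_sub_distrib, ← Finset.mul_sum]

/-- The blocks labelled by `e` and `e'`, with the elements chosen by `σ` distinguished. -/
def HiddenBlocks.ofTransversal (e e' : Fin a × Fin (K + 1) ↪ Fin n)
    (hd : Disjoint (Finset.univ.map e) (Finset.univ.map e')) (σ : Fin a → Fin (K + 1)) :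
    HiddenBlocks n K a where
  A := Finset.univ.map e
  B := Finset.univ.map e'
  A₁ := transversal e σ
  -- The same `σ` serves both blocks: the two tail bounds are joined by a union bound, which needs
  -- no independence.
  B₁ := transversal e' σ
  disjoint := hd
  subset_A := by intro x; simp only [transversal, Finset.mem_map]; rintro ⟨i, -, rfl⟩; exact ⟨_, Finset.mem_univ _, rfl⟩
  subset_B := by intro x; simp only [transversal, Finset.mem_map]; rintro ⟨i, -, rfl⟩; exact ⟨_, Finset.mem_univ _, rfl⟩
  card_A := by simp [mul_comm]
  card_B := by simp [mul_comm]
  card_A₁ := by simp [transversal]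
  card_B₁ := by simp [transversal]

theorem exists_disjoint_embeddings (h : 2 * ((K + 1) * a) ≤ n) :
    ∃ e e' : Fin a × Fin (K + 1) ↪ Fin n,
      Disjoint (Finset.univ.map e) (Finset.univ.map e') := by
  have h' : a * (K + 1) + a * (K + 1) ≤ n := by linarith [mul_comm a (K + 1)]
  let c := Fin.castLEEmb h'
  refine ⟨finProdFinEquiv.toEmbedding.trans ((Fin.castAddEmb (a * (K + 1))).trans c),
    finProdFinEquiv.toEmbedding.trans ((Fin.natAddEmb (a * (K + 1))).trans c), ?_⟩
  rw [Finset.disjoint_left]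
  intro x hx hx'
  simp only [Finset.mem_map, Finset.mem_univ, true_and] at hx hx'
  obtain ⟨u, rfl⟩ := hx
  obtain ⟨v, hv⟩ := hx'
  have h1 := congrArg Fin.val hv
  have h2 := (finProdFinEquiv u).isLt
  simp [c, -finProdFinEquiv_apply_val] at h1
  omega

end Transversal

/-! ### Harmonic weights and the perturbation. -/

/-- Each of the `M` dyadic blocks contributes at least `1 / 2`. -/
theorem le_sum_Ico_inv (b M : ℕ) (hb : 1 ≤ b) :
    (M : ℝ) / 2 ≤ ∑ j ∈ Finset.Ico b (2 ^ M * b), (j : ℝ)⁻¹ := by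
  induction M with
  | zero => simp
  | succ M ih =>
    have h1 : b ≤ 2 ^ M * b := Nat.le_mul_of_pos_left b (by positivity)
    have h2 : 2 ^ M * b ≤ 2 ^ (M + 1) * b := Nat.mul_le_mul_right b (by gcongr <;> norm_num)
    rw [← Finset.sum_Ico_consecutive _ h1 h2]
    have h3 : (1 : ℝ) / 2 ≤ ∑ j ∈ Finset.Ico (2 ^ M * b) (2 ^ (M + 1) * b), (j : ℝ)⁻¹ := by
      have hb' : (0 : ℝ) < b := by exact_mod_cast hb
      calc (1 : ℝ) / 2 = ∑ j ∈ Finset.Ico (2 ^ M * b) (2 ^ (M + 1) * b),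
            ((2 : ℝ) ^ (M + 1) * b)⁻¹ := by
            rw [Finset.sum_const, Nat.card_Ico, nsmul_eq_mul, Nat.cast_sub h2]
            push_cast
            field_simp
            ring
        _ ≤ _ := by
            refine Finset.sum_le_sum fun j hj => ?_
            rw [Finset.mem_Ico] at hj
            have hj0 : 0 < j := lt_of_lt_of_le (by positivity) hj.1
            have hj1 : (j : ℝ) ≤ 2 ^ (M + 1) * b := by exact_mod_cast hj.2.le
            have : (0 : ℝ) < j := by exact_mod_cast hj0
            gcongr
    push_cast
    linarith

/-- There is a mild perturbation which vanishes near the origin, and is comparable to the product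
of its arguments far away from it. -/
theorem exists_isMild (K b : ℕ) (hK : 2 ≤ K) (hb : 1 ≤ b) :
    ∃ Ψ : ℤ → ℤ → ℝ, IsMild K Ψ ∧ (∀ p q : ℤ, |p| ≤ b → |q| ≤ b → Ψ p q = 0) ∧
      (∀ p q : ℤ, Ψ p q ≤ |(p : ℝ) * q|) ∧
      ∀ p : ℕ, 2 * (2 ^ (2 * K ^ 2) * b) ≤ p → 3 / 4 * (p : ℝ) ^ 2 ≤ Ψ p p := by
  -- The `2 * K ^ 2` dyadic blocks give total harmonic mass `W ≥ K ^ 2`. The weights `1 / (j * W)`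
  -- then satisfy `w j * j = 1 / W ≤ 1 / K ^ 2`, as is needed for steps of size up to `K`.
  set s := Finset.Ico b (2 ^ (2 * K ^ 2) * b) with hs
  set W := ∑ j ∈ s, (j : ℝ)⁻¹ with hW
  have hKW : (K : ℝ) ^ 2 ≤ W := by
    have := le_sum_Ico_inv b (2 * K ^ 2) hb
    push_cast at this
    linarith
  have hK0 : (0 : ℝ) < K := by exact_mod_cast (by omega : 0 < K)
  have hW0 : 0 < W := lt_of_lt_of_le (by positivity) hKW
  have hw0 : ∀ j ∈ s, 0 ≤ (j : ℝ)⁻¹ / W := fun j _ => by positivity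
  have hw1 : ∑ j ∈ s, (j : ℝ)⁻¹ / W = 1 := by rw [← Finset.sum_div, div_self hW0.ne']
  have hw : ∀ j ∈ s, (j : ℝ)⁻¹ / W * j ≤ 1 / W := fun j hj => by
    have hj0 : (0 : ℝ) < j := by
      exact_mod_cast (lt_of_lt_of_le hb (Finset.mem_Ico.1 hj).1 : 0 < j)
    rw [div_mul_eq_mul_div, inv_mul_cancel₀ hj0.ne']
  refine ⟨flatProd s fun j => (j : ℝ)⁻¹ / W, isMild_flatProd hw0 hw1 hw (by positivity) ?_,
    fun p q => flatProd_eq_zero fun j hj => (Finset.mem_Ico.1 hj).1,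
    flatProd_le_abs hw0 hw1, fun p hp => le_flatProd_self hw0 hw1 fun j hj => ?_⟩
  · rw [div_mul_eq_mul_div, one_mul, div_le_one hW0]
    linarith [sq (K : ℝ)]
  · have := (Finset.mem_Ico.1 hj).2
    omega

/-! ### Comparison of the hidden instances with the symmetric one. -/

namespace HiddenBlocks

variable {n K a : ℕ} (hK : 1 ≤ K) {Ψ : ℤ → ℤ → ℝ} (h : IsMild K Ψ)

theorem objective_le_of_feasible (D : HiddenBlocks n K a)
    (hΨ : ∀ p q : ℤ, Ψ p q ≤ |(p : ℝ) * q|) {S : Finset (Fin n)}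
    (hS : (D.toInstance hK h).Feasible S) : D.objective Ψ S ≤ 3 * K ^ 2 * a ^ 2 := by
  refine (D.objective_eq_of_feasible hK h hS).trans_le ?_
  have h1 := D.abs_imbalance_mul_le hK h hS
  have h2 := hΨ (D.imbalanceA S) (D.imbalanceB S)
  have h3 : (K : ℝ) ≤ K ^ 2 := by exact_mod_cast Nat.le_self_pow two_ne_zero K
  have h4 : (K : ℝ) * a ^ 2 ≤ K ^ 2 * a ^ 2 := mul_le_mul_of_nonneg_right h3 (sq_nonneg _)
  linarith

theorem le_objective_optimum (D : HiddenBlocks n K a)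
    (hΨ : 3 / 4 * ((K * a : ℕ) : ℝ) ^ 2 ≤ Ψ (K * a : ℕ) (K * a : ℕ)) :
    3 / 4 * ((K : ℝ) ^ 2 * a ^ 2) ≤ D.objective Ψ D.optimum := by
  obtain ⟨h1, h2, h3, h4⟩ := D.optimum_inter
  rw [objective_eq, D.imbalance_optimum.1, D.imbalance_optimum.2, h1, h3, D.card_A₁,
    D.card_B_sdiff]
  push_cast at hΨ ⊢
  have h5 : (0 : ℝ) ≤ K * a ^ 2 := by positivity
  linarith

/-- The objectives for a random transversal rarely differ from the symmetric objective. -/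
theorem card_objective_ne_le (e e' : Fin a × Fin (K + 1) ↪ Fin n)
    (hd : Disjoint (Finset.univ.map e) (Finset.univ.map e')) {b : ℕ}
    (hΨ : ∀ p q : ℤ, |p| ≤ b → |q| ≤ b → Ψ p q = 0) (S : Finset (Fin n)) {t : ℝ} (ht : 0 ≤ t)
    (htK : t * (K + 1) ≤ 1) (τ : Fin a → Fin (K + 1)) :
    ((Finset.univ.filter fun σ => (ofTransversal e e' hd σ).objective Ψ S ≠
        (ofTransversal e e' hd τ).objective (fun _ _ => 0) S).card : ℝ) ≤
      Fintype.card (Fin a → Fin (K + 1)) *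
        (4 * Real.exp (a * (t * (K + 1)) ^ 2 - t * b)) := by
  have h1 := card_imbalance_transversal_le e S b ht htK
  have h2 := card_imbalance_transversal_le e' S b ht htK
  have hsub : (Finset.univ.filter fun σ => (ofTransversal e e' hd σ).objective Ψ S ≠
        (ofTransversal e e' hd τ).objective (fun _ _ => 0) S) ⊆
      (Finset.univ.filter fun σ : Fin a → Fin (K + 1) =>
        (b : ℝ) < |((K : ℝ) + 1) * (S ∩ transversal e σ).card -
          (S ∩ Finset.univ.map e).card|) ∪
      (Finset.univ.filter fun σ : Fin a → Fin (K + 1) =>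
        (b : ℝ) < |((K : ℝ) + 1) * (S ∩ transversal e' σ).card -
          (S ∩ Finset.univ.map e').card|) := by
    intro σ
    simp only [Finset.mem_filter, Finset.mem_univ, true_and, Finset.mem_union]
    contrapose!
    rintro ⟨hA', hB'⟩
    have hp : |(ofTransversal e e' hd σ).imbalanceA S| ≤ b := by
      have : |((ofTransversal e e' hd σ).imbalanceA S : ℝ)| ≤ b := by
        unfold imbalanceA; push_cast; exact hA'
      exact_mod_cast this
    have hq : |(ofTransversal e e' hd σ).imbalanceB S| ≤ b := by
      have : |((ofTransversal e e' hd σ).imbalanceB S : ℝ)| ≤ b := by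
        unfold imbalanceB; push_cast; rw [abs_sub_comm]; exact hB'
      exact_mod_cast this
    rw [objective_eq, objective_eq, hΨ _ _ hp hq]
    rfl
  have h3 := (Nat.cast_le (α := ℝ)).2
    ((Finset.card_le_card hsub).trans (Finset.card_union_le _ _))
  rw [Nat.cast_add] at h3
  linarith

/-- Membership queries reveal nothing about `A₁` and `B₁`, which is why they need not be counted. -/
theorem toInstance_matroid_eq {D D' : HiddenBlocks n K a} (hA : D.A = D'.A) (hB : D.B = D'.B)
    {Ψ' : ℤ → ℤ → ℝ} (h' : IsMild K Ψ') :
    (D.toInstance hK h).matroid = (D'.toInstance hK h').matroid := by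
  simp only [toInstance, hA, hB]

end HiddenBlocks

/-! ### The query lower bound. -/

/-- If an approximation algorithm makes few queries on the symmetric instance, then the average
over the hidden transversals bounds its approximation factor. -/
theorem approximation_factor_le_of_isMild {n K a b : ℕ} (hK : 1 ≤ K) (ha : 0 < a)
    (hn : 2 * ((K + 1) * a) ≤ n) {Ψ : ℤ → ℤ → ℝ} (hΨ : IsMild K Ψ)
    (hΨ0 : ∀ p q : ℤ, |p| ≤ b → |q| ≤ b → Ψ p q = 0) (hΨle : ∀ p q : ℤ, Ψ p q ≤ |(p : ℝ) * q|)
    (hΨge : 3 / 4 * ((K * a : ℕ) : ℝ) ^ 2 ≤ Ψ (K * a : ℕ) (K * a : ℕ))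
    {t : ℝ} (ht : 0 ≤ t) (htK : t * (K + 1) ≤ 1) {c : ℝ} (hc : 0 ≤ c)
    (A : RandomizedAlgorithm.{u} n) (hA : A.IsApproximation c) :
    ∃ I : MatroidBaseInstance n, A.expectedValueQueries I ≠ ⊤ →
      3 / 4 * c * K ^ 2 ≤ 2 * K + 12 * K ^ 2 * Real.exp (a * (t * (K + 1)) ^ 2 - t * b) *
          ((A.expectedValueQueries I).toReal + 1) := by
  obtain ⟨e, e', hd⟩ := exists_disjoint_embeddings hn
  let f : (Fin a → Fin (K + 1)) → MatroidBaseInstance n := fun σ =>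
    (HiddenBlocks.ofTransversal e e' hd σ).toInstance hK hΨ
  let D₀ := HiddenBlocks.ofTransversal e e' hd fun _ => 0
  refine ⟨D₀.toInstance hK (isMild_zero K), fun hQ => ?_⟩
  have ha0 : (0 : ℝ) < a := Nat.cast_pos.2 ha
  have hgv : ∀ S, (D₀.toInstance hK (isMild_zero K)).Feasible S →
      (D₀.toInstance hK (isMild_zero K)).f S ≤ 2 * K * a ^ 2 := fun S hS =>
    (D₀.objective_eq_of_feasible hK (isMild_zero K) hS).trans_le (by rw [add_zero])
  have hsum := A.sum_expectedValue_le (D₀.toInstance hK (isMild_zero K)) f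
    (fun _ => HiddenBlocks.toInstance_matroid_eq hK hΨ rfl rfl (isMild_zero K))
    (by positivity) (V := 3 * K ^ 2 * a ^ 2) (by positivity) (by positivity) hgv
    (fun σ S hS => HiddenBlocks.objective_le_of_feasible hK hΨ _ hΨle hS)
    (fun S => HiddenBlocks.card_objective_ne_le e e' hd hΨ0 S ht htK _) hQ
  have hopt : ∀ σ, c * (3 / 4 * (K ^ 2 * a ^ 2)) ≤ A.expectedValue (f σ) := fun σ =>
    (mul_le_mul_of_nonneg_left (HiddenBlocks.le_objective_optimum _ hΨge) hc).trans
      (hA (f σ) _ (HiddenBlocks.feasible_optimum _ hK hΨ))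
  have hlow := (Finset.card_nsmul_le_sum Finset.univ _ _ fun σ _ => hopt σ).trans hsum
  rw [nsmul_eq_mul, Finset.card_univ] at hlow
  have h1 := le_of_mul_le_mul_left hlow (Nat.cast_pos.2 Fintype.card_pos)
  refine le_of_mul_le_mul_right ?_ (pow_pos ha0 2)
  linarith

/-- Here `a = 2 ^ (2 * K ^ 2) * b`, so that the optimum, with both imbalances `K * a ≥ 2 * a`, lies
beyond twice every scale. The parameter `t = b / (2 * a * (K + 1) ^ 2)` minimizes the Chernoff
exponent. -/
theorem approximation_factor_le {n K b : ℕ} (hK : 2 ≤ K) (hb : 1 ≤ b)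
    (hn : 2 * ((K + 1) * (2 ^ (2 * K ^ 2) * b)) ≤ n) {c : ℝ} (hc : 0 ≤ c)
    (A : RandomizedAlgorithm.{u} n) (hA : A.IsApproximation c) :
    ∃ I : MatroidBaseInstance n, A.expectedValueQueries I ≠ ⊤ →
      3 / 4 * c * K ^ 2 ≤ 2 * K + 12 * K ^ 2 *
        Real.exp (-(b / (4 * (K + 1) ^ 2 * 2 ^ (2 * K ^ 2)))) *
          ((A.expectedValueQueries I).toReal + 1) := by
  obtain ⟨Ψ, hΨ, hΨ0, hΨle, hΨge⟩ := exists_isMild K b hK hb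
  have htK : 1 / (2 * ((K : ℝ) + 1) ^ 2 * 2 ^ (2 * K ^ 2)) * (K + 1) ≤ 1 := by
    rw [div_mul_eq_mul_div, one_mul, div_le_one (by positivity)]
    have h1 : (1 : ℝ) ≤ 2 ^ (2 * K ^ 2) := one_le_pow₀ (by norm_num)
    have h2 : (0 : ℝ) ≤ K := K.cast_nonneg
    calc (K : ℝ) + 1 ≤ 2 * (K + 1) ^ 2 := by nlinarith
      _ ≤ _ := le_mul_of_one_le_right (by positivity) h1
  have hexp : ((2 ^ (2 * K ^ 2) * b : ℕ) : ℝ) *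
      (1 / (2 * ((K : ℝ) + 1) ^ 2 * 2 ^ (2 * K ^ 2)) * (K + 1)) ^ 2 -
        1 / (2 * ((K : ℝ) + 1) ^ 2 * 2 ^ (2 * K ^ 2)) * b =
      -(b / (4 * (K + 1) ^ 2 * 2 ^ (2 * K ^ 2))) := by
    push_cast
    field_simp
    ring
  rw [← hexp]
  exact approximation_factor_le_of_isMild (by omega) (by positivity) hn hΨ hΨ0 hΨle
    (hΨge _ (Nat.mul_le_mul_right _ hK)) (by positivity) htK hc A hA

theorem corollary1p3 (c : ℝ) (hc : 0 < c) :
    ∃ δ : ℝ, 0 < δ ∧ ∃ n₀ : ℕ, ∀ n : ℕ, n₀ ≤ n →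
      ∀ A : RandomizedAlgorithm.{u} n, A.IsApproximation c →
        ∃ I : MatroidBaseInstance n,
          ENNReal.ofReal (Real.exp (δ * n)) ≤ A.expectedValueQueries I := by
  -- With `c * K > 4` the left side `3/4 * c * K ^ 2` exceeds `3 * K`, whereas the right side will
  -- be at most `2 * K + K`.
  obtain ⟨K, hKc⟩ := exists_nat_gt (max 2 (4 / c))
  have hK2 : 2 ≤ K := by exact_mod_cast (lt_of_le_of_lt (le_max_left _ _) hKc).le
  have hcK : 4 < c * K := by
    have := lt_of_le_of_lt (le_max_right _ _) hKc
    rwa [div_lt_iff₀ hc, mul_comm] at this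
  have hK0 : (0 : ℝ) < K := by exact_mod_cast (by omega : 0 < K)
  set L := 2 * ((K + 1) * 2 ^ (2 * K ^ 2)) with hL
  have hL0 : 0 < L := by positivity
  have hL0' : (0 : ℝ) < L := by exact_mod_cast hL0
  set R : ℝ := 4 * (K + 1) ^ 2 * 2 ^ (2 * K ^ 2) with hR
  have hR0 : 0 < R := by positivity
  -- One factor 2 pays for rounding in `n / L`; the other makes the failure probability of order
  -- `exp (-2 * δ * n)`, which beats `exp (δ * n)` queries.
  set δ : ℝ := 1 / (4 * L * R) with hδ
  have hδ0 : 0 < δ := by positivity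
  obtain ⟨n₁, hn₁⟩ := exists_nat_gt (24 * K / δ)
  refine ⟨δ, hδ0, max L n₁, fun n hn A hA => ?_⟩
  have hnL : L ≤ n := (le_max_left _ _).trans hn
  have hnδ : 24 * K ≤ δ * n := by
    have h1 : (n₁ : ℝ) ≤ n := by exact_mod_cast (le_max_right _ _).trans hn
    have h2 := hn₁.le.trans h1
    rwa [div_le_iff₀ hδ0, mul_comm (n : ℝ)] at h2
  have hb : 1 ≤ n / L := (Nat.one_le_div_iff hL0).2 hnL
  have hbn : 2 * ((K + 1) * (2 ^ (2 * K ^ 2) * (n / L))) ≤ n := by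
    calc _ = L * (n / L) := by rw [hL]; ring
      _ ≤ n := Nat.mul_div_le n L
  obtain ⟨I, hI⟩ := approximation_factor_le hK2 hb hbn hc.le A hA
  refine ⟨I, ?_⟩
  by_contra! hlt
  have hQ := (lt_top_of_lt hlt).ne
  have hQe : (A.expectedValueQueries I).toReal < Real.exp (δ * n) := by
    rwa [← ENNReal.ofReal_toReal hQ, ENNReal.ofReal_lt_ofReal_iff (Real.exp_pos _)] at hlt
  have hbig : (n : ℝ) ≤ 2 * L * (n / L : ℕ) := by
    have h1 := Nat.div_add_mod n L
    have h2 := Nat.mod_lt n hL0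
    have h3 : L ≤ L * (n / L) := Nat.le_mul_of_pos_right L hb
    have h4 : n ≤ 2 * L * (n / L) := by nlinarith
    exact_mod_cast h4
  have hε : Real.exp (-((n / L : ℕ) / R)) ≤ Real.exp (-(2 * (δ * n))) := by
    gcongr
    rw [hδ, le_div_iff₀ hR0]
    calc _ = (n : ℝ) / (2 * L) := by field_simp; ring
      _ ≤ _ := by rw [div_le_iff₀ (by positivity)]; linarith
  have hexp : 24 * K ≤ Real.exp (δ * n) := by linarith [Real.add_one_le_exp (δ * n)]
  have hone : 1 ≤ Real.exp (δ * n) := Real.one_le_exp (by positivity)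
  have hfin : 12 * (K : ℝ) ^ 2 * Real.exp (-((n / L : ℕ) / R)) *
      ((A.expectedValueQueries I).toReal + 1) ≤ K := by
    calc _ ≤ 12 * (K : ℝ) ^ 2 * Real.exp (-(2 * (δ * n))) * (2 * Real.exp (δ * n)) := by
          gcongr; linarith
      _ = 24 * K ^ 2 / Real.exp (δ * n) := by
          rw [Real.exp_neg, two_mul (δ * n), Real.exp_add]
          field_simp
          ring
      _ ≤ K := by
          rw [div_le_iff₀ (Real.exp_pos _)]
          nlinarith
  have := hI hQ
  nlinarith
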